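/- Let $\varepsilon_1,\dots,\varepsilon_N\in\mathbb{R}$ be distinct and $g\in\mathbb{R}\setminus\{0\}$. For $N$ spatial orbitals with fermionic operators $a^\dagger_{i\sigma},a_{i\sigma}$ ($\sigma\in\{\uparrow,\downarrow\}$) put $S^+_i=a^\dagger_{i\uparrow}a^\dagger_{i\downarrow}$, $S^-_i=a_{i\downarrow}a_{i\uparrow}$, $S^z_i=\frac12(a^\dagger_{i\uparrow}a_{i\uparrow}+a^\dagger_{i\downarrow}a_{i\downarrow}-1)$, $\hat n_i=2S^z_i+1$ and $S^+(w)=\sum_{i=1}^N\frac{S^+_i}{w-\varepsilon_i}$. Let $|\theta\rangle$ be a unit vector of a fermionic Fock space over finitely many spatial orbitals, containing the $N$ given ones, such that $S^-_i|\theta\rangle=0$ and $\hat n_i|\theta\rangle=0$ for $i=1,\dots,N$ (e.g. the physical vacuum). For complex numbers $\{v\}=\{v_1,\dots,v_M\}$, all different from every $\varepsilon_i$ but otherwise arbitrary, define $$|\{v\}\rangle=S^+(v_1)\cdots S^+(v_M)|\theta\rangle,\qquad V_i=\sum_{a=1}^M\frac{1}{\varepsilon_i-v_a}\quad(i=1,\dots,N),$$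 the $V_i$ being the eigenvalue-based variables (EBV). Let $\{u\}=\{u_1,\dots,u_M\}$ be on-shell: the $u_a\in\mathbb{C}$ are distinct, different from every $\varepsilon_i$, and satisfy Richardson's equations $$\frac2g+\sum_{i=1}^N\frac1{u_a-\varepsilon_i}+\sum_{b\neq a}\frac{2}{u_b-u_a}=0,\qquad a=1,\dots,M,$$ and let $U_i=\sum_a\frac1{\varepsilon_i-u_a}$. Put $\eta=(-1)^{N-M}(g/2)^{N-2M}$ and let $J$ be the $N\times N$ matrix with $$J_{ii}=U_i+V_i-\frac2g+\sum_{k\neq i}\frac1{\varepsilon_k-\varepsilon_i},\qquad J_{ij}=\frac1{\varepsilon_i-\varepsilon_j}\quad(i\neq j).$$ Let $\bar J$ be the matrix $J$ for $V=U$. For a matrix $A$ and a vector $X$ let $A(k\to X)$ denote $A$ with its $k$-th column replaced by $X$. Then, for every such $\{v\}$ and every $k=1,\dots,N$, $$\tfrac12\langle\{u\}|\hat n_k|\{v\}\rangle=\eta\,\det J(k\to V).$$ Moreover, if $|\{u\}\rangle\neq0$, then $\det\bar J\neq0$, and the normalized 1-RDM $\gamma_k=\frac12\,\frac{\langle\{u\}|\hat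 n_k|\{u\}\rangle}{\langle\{u\}|\{u\}\rangle}$ satisfies $$\gamma_k=\frac{\det\bar J(k\to U)}{\det\bar J}\qquad(k=1,\dots,N).$$ Equivalently, $\gamma$ is the unique solution of the linear system $\bar J\gamma=U$, that is, $\gamma_k=\sum_{l=1}^N U_l\,(\bar J^{-1})_{kl}$. -/

import Mathlib

open scoped BigOperators

namespace RG

noncomputable section

/-- Spin-orbitals (modes) of a system with `L` spatial orbitals, ordered lexicographically;
the second component is the spin: `false` is up and `true` is down. -/
abbrev Mode (L : ℕ) : Type := Fin L ×ₗ Bool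

/-- The spin-orbital with spatial orbital `p` and spin `s`. -/
def mode {L : ℕ} (p : Fin L) (s : Bool) : Mode L := toLex (p, s)

/-- The fermionic Fock space over `L` spatial orbitals. The value of a vector at a finite set `S`
of modes is its coordinate along the Slater determinant in which exactly the modes of `S` are
occupied; these determinants form an orthonormal basis. -/
abbrev Fock (L : ℕ) : Type := EuclideanSpace ℂ (Finset (Mode L))

/-- The fermionic sign `(-1)^(number of occupied modes that precede p)`. -/
def fsign {L : ℕ} (p : Mode L) (S : Finset (Mode L)) : ℂ :=
  (-1) ^ (S.filter (fun q => q < p)).card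

/-- The creation operator `a†_p`: it sends the determinant `S` to `0` if `p ∈ S` and to
`fsign p S` times the determinant `insert p S` otherwise. -/
def create {L : ℕ} (p : Mode L) : Module.End ℂ (Fock L) where
  toFun ψ := WithLp.toLp 2 fun S => if p ∈ S then fsign p S * ψ (S.erase p) else 0
  map_add' ψ φ := by
    ext S
    by_cases h : p ∈ S <;> simp [h, mul_add]
  map_smul' c ψ := by
    ext S
    by_cases h : p ∈ S <;> simp [h, mul_left_comm]

/-- The annihilation operator `a_p`: it sends the determinant `S` to `0` if `p ∉ S` and to
`fsign p S` times the determinant `S.erase p` otherwise. -/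
def annihilate {L : ℕ} (p : Mode L) : Module.End ℂ (Fock L) where
  toFun ψ := WithLp.toLp 2 fun S => if p ∈ S then 0 else fsign p S * ψ (insert p S)
  map_add' ψ φ := by
    ext S
    by_cases h : p ∈ S <;> simp [h, mul_add]
  map_smul' c ψ := by
    ext S
    by_cases h : p ∈ S <;> simp [h, mul_left_comm]

/-- `S⁺ = a†_↑ a†_↓` in the spatial orbital `p`. -/
def pairCreate {L : ℕ} (p : Fin L) : Module.End ℂ (Fock L) :=
  create (mode p false) * create (mode p true)

/-- `S⁻ = a_↓ a_↑` in the spatial orbital `p`. -/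
def pairAnnihilate {L : ℕ} (p : Fin L) : Module.End ℂ (Fock L) :=
  annihilate (mode p true) * annihilate (mode p false)

/-- `Sᶻ = (1/2) (a†_↑ a_↑ + a†_↓ a_↓ - 1)` in the spatial orbital `p`. -/
def spinZ {L : ℕ} (p : Fin L) : Module.End ℂ (Fock L) :=
  (1 / 2 : ℂ) • (create (mode p false) * annihilate (mode p false)
    + create (mode p true) * annihilate (mode p true) - 1)

/-- The number operator `n̂ = 2 Sᶻ + 1` of the spatial orbital `p`. -/
def numberOp {L : ℕ} (p : Fin L) : Module.End ℂ (Fock L) :=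
  (2 : ℂ) • spinZ p + 1

/-- `θ` is a (normalized) vacuum for the pairing orbitals `orb 0, …, orb (N - 1)`: it is destroyed
by every pair removal operator and by every number operator of these orbitals. The remaining
spatial orbitals, if any, do not participate in the pairing and may be occupied in `θ`. -/
structure IsPairVacuum {N L : ℕ} (orb : Fin N ↪ Fin L) (θ : Fock L) : Prop where
  norm_eq_one : ‖θ‖ = 1
  pairAnnihilate_eq_zero : ∀ i, pairAnnihilate (orb i) θ = 0
  numberOp_eq_zero : ∀ i, numberOp (orb i) θ = 0

/-- The delocalized pair creator `S⁺(w) = ∑ i, S⁺_i / (w - ε_i)`. -/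
def pairCreator {N L : ℕ} (orb : Fin N ↪ Fin L) (ε : Fin N → ℝ) (w : ℂ) :
    Module.End ℂ (Fock L) :=
  ∑ i, (1 / (w - (ε i : ℂ))) • pairCreate (orb i)

/-- The state `|{v}⟩ = S⁺(v_1) S⁺(v_2) ⋯ S⁺(v_M) |θ⟩`. -/
def rgState {N L M : ℕ} (orb : Fin N ↪ Fin L) (θ : Fock L) (ε : Fin N → ℝ) (v : Fin M → ℂ) :
    Fock L :=
  (List.ofFn fun a => pairCreator orb ε (v a)).prod θ

/-- No rapidity coincides with a single-particle energy. -/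
def Admissible {N M : ℕ} (ε : Fin N → ℝ) (v : Fin M → ℂ) : Prop :=
  ∀ a i, v a ≠ (ε i : ℂ)

/-- The rapidities `u` are on-shell: they are distinct from each other and from the
single-particle energies (so no denominator vanishes), and solve Richardson's equations. -/
structure OnShell {N M : ℕ} (ε : Fin N → ℝ) (g : ℝ) (u : Fin M → ℂ) : Prop where
  admissible : Admissible ε u
  injective : Function.Injective u
  richardson : ∀ a, 2 / (g : ℂ) + ∑ i, 1 / (u a - (ε i : ℂ))
    + ∑ b ∈ Finset.univ.erase a, 2 / (u b - u a) = 0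

/-- The eigenvalue-based variables `V_i = ∑ a, 1 / (ε_i - v_a)`. -/
def ebv {N M : ℕ} (ε : Fin N → ℝ) (v : Fin M → ℂ) : Fin N → ℂ :=
  fun i => ∑ a, 1 / ((ε i : ℂ) - v a)

/-- The matrix `J` of two vectors `U`, `V` of eigenvalue-based variables. -/
def matJ {N : ℕ} (ε : Fin N → ℝ) (g : ℝ) (U V : Fin N → ℂ) : Matrix (Fin N) (Fin N) ℂ :=
  Matrix.of fun i j =>
    if i = j then
      U i + V i - 2 / (g : ℂ) + ∑ k ∈ Finset.univ.erase i, 1 / ((ε k : ℂ) - (ε i : ℂ))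
    else 1 / ((ε i : ℂ) - (ε j : ℂ))

/-- The matrix `J̄`, which is `J` with both vectors equal to `U`. -/
def matJbar {N : ℕ} (ε : Fin N → ℝ) (g : ℝ) (U : Fin N → ℂ) : Matrix (Fin N) (Fin N) ℂ :=
  matJ ε g U U

/-- The constant `η = (-1)^(N - M) (g / 2)^(N - 2 M)`, with integer exponents. -/
def eta (N M : ℕ) (g : ℝ) : ℂ :=
  (-1) ^ ((N : ℤ) - (M : ℤ)) * ((g : ℂ) / 2) ^ ((N : ℤ) - 2 * (M : ℤ))

/-- The (diagonal) 1-RDM `γ_k = (1/2) ⟨ψ|n̂_k|ψ⟩ / ⟨ψ|ψ⟩` of a state `ψ`. -/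
def oneRDM {N L : ℕ} (orb : Fin N ↪ Fin L) (ψ : Fock L) : Fin N → ℂ :=
  fun k => (1 / 2) * (inner ℂ ψ (numberOp (orb k) ψ) / inner ℂ ψ ψ)

end

end RG

/-! Everything rests on a determinant that counts matchings. For nodes `z` and rapidities `v`,
`gaudinDet z J (s + V)` is the sum over partial matchings between the nodes in `J` and the
rapidities, with weight `1 / (z i - v a)` for a matched pair and `s` for an unmatched node. With `s
= 0` and equally many nodes and rapidities it is the permanent of the Cauchy matrix, which is, up to
sign, the coefficient of the pair state `I` in `|{v}⟩` (`rgState_eq_sum`).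

Seen from the side of the rapidities, the same matchings give a Gaudin-type determinant in the `u a`
(`gaudinDet_exchange`). Richardson's equations say that the matrix there for a set of nodes, shifted
by `c = 2 / g`, is minus the transpose of the unshifted matrix for the complement
(`RichardsonSolution.gaudinDet_swap`). Hence the coefficient of an on-shell state at `I` is `η`
times a determinant over the empty orbitals `Iᶜ` with diagonal shift `-c + U`.

The overlap is thus a sum over `I` of a determinant on `I` in `V` times one on `Iᶜ` in `-c + U`. By
`gaudinDet_add_partialEbv` it collapses to a single determinant with diagonal `-c + U + V`, which is
`det J`. Restricting to `k ∈ I` replaces column `k` by `V`.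

The inner product conjugates the coefficients of `u`, so these must be real. If `u` and its
conjugate have the same EBV, this is clear. Otherwise the two on-shell states are orthogonal, which
forces every coefficient to vanish (`OnShell.conj_pairCoeff_eq`). The statements on `γ` are then
Cramer's rule. -/

namespace RG

/-! ### Gaudin-type determinants: column replacement and the addition of a rapidity. -/

section GaudinDeterminant

variable {ι : Type*} [Fintype ι] [DecidableEq ι]

/-- Subtracting a vector `x` from all columns in `s`. -/
theorem det_sub_columns (A : Matrix ι ι ℂ) (x : ι → ℂ) (s : Finset ι) :
    (Matrix.of fun i j => A i j - if j ∈ s then x i else 0).det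
      = A.det - ∑ j ∈ s, (A.updateCol j x).det := by
  induction s using Finset.induction_on with
  | empty => simp; rfl
  | insert a s ha ih =>
    rw [Finset.sum_insert ha]
    set B : Matrix ι ι ℂ := Matrix.of fun i j => A i j - if j ∈ s then x i else 0 with hB
    have h1 : (Matrix.of fun i j => A i j - if j ∈ insert a s then x i else 0)
        = B.updateCol a ((fun i => B i a) + (-1 : ℂ) • x) := by
      ext i j
      by_cases hj : j = a
      · subst hj; simp [hB, ha]; ring
      · simp [hB, hj]
    -- Once column `a` is `x` itself, the subtractions in the other columns are column operations.
    -- This is why no terms of higher order in `x` appear.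
    have h2 : (B.updateCol a x).det = (A.updateCol a x).det := by
      rw [← Matrix.det_transpose, ← Matrix.det_transpose (A.updateCol a x)]
      refine Matrix.det_eq_of_forall_row_eq_smul_add_const
        (fun j => if j ∈ s then -1 else 0) a (by simp [ha]) ?_
      intro j i
      by_cases hj : j = a
      · subst hj; simp [ha]
      · by_cases hs : j ∈ s <;> simp [hB, hj, hs, sub_eq_add_neg]
    have h3 : B.updateCol a (fun i => B i a) = B := Matrix.updateCol_eq_self B a
    rw [h1, Matrix.det_updateCol_add, Matrix.det_updateCol_smul, h2, h3, ih]
    ring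

/-- The Gaudin-type matrix with nodes `z`, restricted to the nodes in `J` and completed by the
identity on the other nodes; the sum of the entries of a row `i ∈ J` is `W i`. -/
noncomputable def gaudinMatrix (z : ι → ℂ) (J : Finset ι) (W : ι → ℂ) : Matrix ι ι ℂ :=
  Matrix.of fun i j =>
    if i = j then (if i ∈ J then W i + ∑ k ∈ J.erase i, 1 / (z k - z i) else 1)
    else if i ∈ J ∧ j ∈ J then 1 / (z i - z j) else 0

/-- The determinant of the Gaudin-type matrix. -/
noncomputable def gaudinDet (z : ι → ℂ) (J : Finset ι) (W : ι → ℂ) : ℂ :=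
  (gaudinMatrix z J W).det

theorem gaudinDet_empty (z W : ι → ℂ) : gaudinDet z ∅ W = 1 := by
  have : gaudinMatrix z ∅ W = 1 := by
    ext i j; simp [gaudinMatrix, Matrix.one_apply]
  rw [gaudinDet, this, Matrix.det_one]

theorem gaudinMatrix_mulVec (z : ι → ℂ) (J : Finset ι) (W f : ι → ℂ) (i : ι) (hi : i ∈ J) :
    (gaudinMatrix z J W).mulVec f i
      = W i * f i + ∑ k ∈ J.erase i, (f i - f k) / (z k - z i) := by
  rw [Matrix.mulVec, dotProduct, ← Finset.add_sum_erase _ _ (Finset.mem_univ i)]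
  have h : ∑ j ∈ Finset.univ.erase i, gaudinMatrix z J W i j * f j
      = ∑ k ∈ J.erase i, 1 / (z i - z k) * f k := by
    symm
    refine Finset.sum_subset_zero_on_sdiff (Finset.erase_subset_erase _ (Finset.subset_univ _))
      ?_ ?_
    · intro k hk
      have : i ≠ k := by rintro rfl; simp at hk
      have : k ∉ J := by intro h; simp [h, Ne.symm this] at hk
      simp [gaudinMatrix, *]
    · intro k hk
      have h1 : i ≠ k := by rintro rfl; simp at hk
      have : k ∈ J := Finset.mem_of_mem_erase hk
      simp [gaudinMatrix, *]
  rw [h]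
  simp only [gaudinMatrix, Matrix.of_apply, if_true, hi, add_mul, add_assoc, Finset.sum_mul,
    ← Finset.sum_add_distrib]
  congr 1
  refine Finset.sum_congr rfl fun k _ => ?_
  rw [← neg_sub (z k) (z i), div_neg]
  ring

/-- Replacing the column `k` by a vector of the form `1 / (q z - p)`. -/
theorem det_updateCol_gaudinMatrix {z : ι → ℂ} (hz : Function.Injective z) {y : ι → ℂ} {q : ℂ}
    (h0 : ∀ i, y i ≠ 0) (hy : ∀ i j, y i - y j = q * (z j - z i) * y i * y j)
    {J : Finset ι} {k : ι} (hk : k ∈ J) (W : ι → ℂ) :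
    ((gaudinMatrix z J (fun i => W i + q * y i)).updateCol k
        (fun i => if i ∈ J then y i else 0)).det
      = y k * gaudinDet z (J.erase k) W := by
  set A := gaudinMatrix z J (fun i => W i + q * y i) with hA
  set A' := A.updateCol k (fun i => if i ∈ J then y i else 0) with hA'
  -- Row elimination: subtracting `y i / y k` times row `k` clears the new column `k` down to its
  -- entry `y k`.
  set c : ι → ℂ := fun i => if i ∈ J.erase k then y i / y k else 0 with hc
  have hck : c k = 0 := by simp [hc]
  set B : Matrix ι ι ℂ := Matrix.of fun i j => A' i j - c i * A' k j with hB
  have hAB : A'.det = B.det := by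
    refine Matrix.det_eq_of_forall_row_eq_smul_add_const c k hck ?_
    intro i j
    simp [hB, hck]
  have hBk : B = B.updateCol k (y k • Pi.single k (1 : ℂ)) := by
    ext i j
    by_cases hj : j = k
    · subst hj
      by_cases hi : i = j
      · subst hi; simp [hB, hc, hA', hk]
      · by_cases hiJ : i ∈ J <;> simp [hB, hc, hA', hi, hiJ, hk, h0]
    · simp [hj]
  -- Both determinants are the same diagonal entry of an adjugate.
  have hrow : (B.updateCol k (Pi.single k (1 : ℂ))).det
      = (B.updateRow k (Pi.single k (1 : ℂ))).det := by
    rw [← Matrix.adjugate_apply, ← Matrix.det_transpose, ← Matrix.updateRow_transpose,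
      ← Matrix.adjugate_apply, ← Matrix.adjugate_transpose, Matrix.transpose_apply]
  -- Conjugation by `(z k - z i) * y i` turns the remaining minor into the Gaudin-type matrix
  -- without node `k`.
  set r : ι → ℂ := fun i => if i = k then 1 else (z k - z i) * y i with hr
  have hr0 : ∀ i, r i ≠ 0 := by
    intro i
    by_cases hi : i = k
    · simp [hr, hi]
    · simp [hr, hi, h0, sub_eq_zero, hz.eq_iff, Ne.symm hi]
  have hconj : B.updateRow k (Pi.single k (1 : ℂ))
      = Matrix.diagonal r * gaudinMatrix z (J.erase k) W * Matrix.diagonal (fun i => (r i)⁻¹) := by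
    ext i j
    rw [Matrix.mul_diagonal, Matrix.diagonal_mul]
    by_cases hi : i = k
    · subst hi
      by_cases hj : j = i
      · subst hj; simp [gaudinMatrix, hr]
      · simp [gaudinMatrix, hj, Ne.symm hj]
    rw [Matrix.updateRow_ne hi]
    by_cases hiJ : i ∈ J
    swap
    · by_cases hij : i = j
      · subst hij
        simp [hB, hc, hiJ, hA', hA, gaudinMatrix, hi, hr0]
      · by_cases hj : j = k
        · subst hj; simp [hB, hc, hiJ, hA', gaudinMatrix, hij]
        · simp [hB, hc, hiJ, hA', hA, gaudinMatrix, hj, hij]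
    by_cases hj : j = k
    · subst hj
      simp [hB, hc, hA', gaudinMatrix, hi, hiJ, hk, h0]
    by_cases hjJ : j ∈ J
    swap
    · have hij : i ≠ j := by rintro rfl; exact hjJ hiJ
      simp [hB, hA', hA, gaudinMatrix, hj, hjJ, hij, Ne.symm hj]
    have hzi : z k - z i ≠ 0 := by simp [sub_eq_zero, hz.eq_iff, Ne.symm hi]
    have hzj : z k - z j ≠ 0 := by simp [sub_eq_zero, hz.eq_iff, Ne.symm hj]
    by_cases hij : i = j
    · subst hij
      have hsum : ∑ l ∈ J.erase i, 1 / (z l - z i)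
          = 1 / (z k - z i) + ∑ l ∈ (J.erase k).erase i, 1 / (z l - z i) := by
        rw [Finset.erase_right_comm,
          Finset.add_sum_erase _ (fun l => 1 / (z l - z i)) (by simp [hk, Ne.symm hi])]
      simp only [hB, hc, hA', hA, gaudinMatrix, Matrix.of_apply, Matrix.updateCol_ne hi,
        if_true, hiJ, hk, Ne.symm hi, if_false, Finset.mem_erase, ne_eq, hi, not_false_eq_true,
        and_self, hsum]
      rw [mul_comm (r i), mul_assoc, mul_inv_cancel₀ (hr0 i), mul_one]
      -- On the diagonal, the elimination cancels `q * y i` together with the contribution of node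
      -- `k`.
      have h1 : q * y i + 1 / (z k - z i) - y i / y k * (1 / (z k - z i)) = 0 := by
        have := hy i k
        have hk0 := h0 k
        field_simp
        linear_combination (-1 : ℂ) * this
      linear_combination h1
    · have hzij : z i - z j ≠ 0 := by simp [sub_eq_zero, hz.eq_iff, hij]
      simp only [hB, hc, hA', hA, gaudinMatrix, Matrix.of_apply, Matrix.updateCol_ne hj,
        hij, hiJ, hjJ, hk, Ne.symm hj, if_false, if_true, Finset.mem_erase, ne_eq, hi, hj,
        not_false_eq_true, and_self, hr]
      have hk0 := h0 k
      have hj0 := h0 j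
      have e1 := hy i k
      have e2 := hy j k
      have e3 := hy i j
      field_simp
      grind
  rw [hAB, hBk, Matrix.det_updateCol_smul, hrow, hconj, Matrix.det_mul, Matrix.det_mul,
    Matrix.det_diagonal, Matrix.det_diagonal, mul_right_comm, ← Finset.prod_mul_distrib,
    Finset.prod_congr rfl fun i _ => mul_inv_cancel₀ (hr0 i)]
  simp [gaudinDet]

theorem inv_sub_sub_inv_sub {x y v : ℂ} (hx : x - v ≠ 0) (hy : y - v ≠ 0) :
    1 / (x - v) - 1 / (y - v) = (1 : ℂ) * (y - x) * (1 / (x - v)) * (1 / (y - v)) := by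
  field_simp
  ring

theorem det_updateCol_gaudinMatrix_rapidity {z : ι → ℂ} (hz : Function.Injective z) {v : ℂ}
    (hv : ∀ i, z i ≠ v) {J : Finset ι} {k : ι} (hk : k ∈ J) (W : ι → ℂ) :
    ((gaudinMatrix z J (fun i => W i + 1 / (z i - v))).updateCol k
        (fun i => if i ∈ J then 1 / (z i - v) else 0)).det
      = 1 / (z k - v) * gaudinDet z (J.erase k) W := by
  have := det_updateCol_gaudinMatrix hz (y := fun i => 1 / (z i - v)) (q := 1)
    (fun i => one_div_ne_zero (sub_ne_zero.2 (hv i)))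
    (fun i j => inv_sub_sub_inv_sub (sub_ne_zero.2 (hv i)) (sub_ne_zero.2 (hv j))) hk W
  simpa only [one_mul] using this

theorem det_updateCol_gaudinMatrix_one {z : ι → ℂ} (hz : Function.Injective z)
    {J : Finset ι} {k : ι} (hk : k ∈ J) (W : ι → ℂ) :
    ((gaudinMatrix z J W).updateCol k (fun i => if i ∈ J then 1 else 0)).det
      = gaudinDet z (J.erase k) W := by
  have := det_updateCol_gaudinMatrix hz (y := fun _ => 1) (q := 0) (by simp) (by simp) hk W
  simpa using this

/-- Adding a rapidity to the diagonal of the Gaudin-type matrix. -/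
theorem gaudinDet_add_rapidity {z : ι → ℂ} (hz : Function.Injective z) {v : ℂ}
    (hv : ∀ i, z i ≠ v) (J : Finset ι) (W : ι → ℂ) :
    gaudinDet z J (fun i => W i + 1 / (z i - v))
      = gaudinDet z J W + ∑ i ∈ J, 1 / (z i - v) * gaudinDet z (J.erase i) W := by
  set x : ι → ℂ := fun i => if i ∈ J then 1 / (z i - v) else 0 with hx
  set A := gaudinMatrix z J (fun i => W i + 1 / (z i - v)) with hA
  have hv0 : ∀ i, z i - v ≠ 0 := fun i => sub_ne_zero.2 (hv i)
  -- Since `1 / (z i - z j) - 1 / (z i - v) = (z j - v) / ((z i - z j) * (z i - v))`, removing the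
  -- rapidity from all columns is a diagonal conjugation, which does not change the determinant.
  have hconj : (Matrix.of fun i j => A i j - if j ∈ J then x i else 0)
      = Matrix.diagonal (fun i => (z i - v)⁻¹) * gaudinMatrix z J W
        * Matrix.diagonal (fun i => z i - v) := by
    ext i j
    rw [Matrix.mul_diagonal, Matrix.diagonal_mul]
    have hi0 := hv0 i
    by_cases hij : i = j
    · subst hij
      by_cases hi : i ∈ J <;> simp [hA, hx, gaudinMatrix, hi] <;> field_simp
      ring
    · by_cases hi : i ∈ J <;> by_cases hj : j ∈ J <;>
        simp [hA, hx, gaudinMatrix, hi, hj, hij]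
      have hzij : z i - z j ≠ 0 := by simp [sub_eq_zero, hz.eq_iff, hij]
      field_simp
      ring
  have hdet := det_sub_columns A x J
  rw [hconj, Matrix.det_mul, Matrix.det_mul, Matrix.det_diagonal, Matrix.det_diagonal,
    mul_right_comm, ← Finset.prod_mul_distrib,
    Finset.prod_congr rfl fun i _ => inv_mul_cancel₀ (hv0 i),
    Finset.sum_congr rfl fun i hi => det_updateCol_gaudinMatrix_rapidity hz hv hi W] at hdet
  simp only [Finset.prod_const_one, one_mul] at hdet
  rw [gaudinDet, gaudinDet, hdet]
  ring

/-! ### Matching expansions and the exchange of nodes with rapidities. -/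

/-- The eigenvalue-based variables of the rapidities `v a`, `a ∈ B`, at the nodes `z`. -/
noncomputable def partialEbv {κ : Type*} (z : ι → ℂ) (v : κ → ℂ) (B : Finset κ) : ι → ℂ :=
  fun i => ∑ a ∈ B, 1 / (z i - v a)

variable {κ : Type*}

/-- The rows of the Gaudin-type matrix sum to the given vector. -/
theorem gaudinDet_eq_det_updateCol (z : ι → ℂ) {J : Finset ι} {k : ι} (hk : k ∈ J) (W : ι → ℂ) :
    gaudinDet z J W
      = ((gaudinMatrix z J W).updateCol k (fun i => if i ∈ J then W i else 0)).det := by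
  -- Column `k` is replaced by the sum of all columns in `J`.
  have h := Matrix.det_updateCol_sum (gaudinMatrix z J W) k (fun i => if i ∈ J then 1 else 0)
  rw [if_pos hk, one_smul] at h
  rw [gaudinDet, ← h]
  congr 2
  ext i
  have h2 : (∑ j, (if j ∈ J then (1 : ℂ) else 0) • gaudinMatrix z J W i j)
      = (gaudinMatrix z J W).mulVec (fun j => if j ∈ J then 1 else 0) i := by
    simp [Matrix.mulVec, dotProduct]
  by_cases hi : i ∈ J
  · rw [h2, gaudinMatrix_mulVec _ _ _ _ _ hi, Finset.sum_eq_zero]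
    · simp [hi]
    · intro l hl
      simp [hi, Finset.mem_of_mem_erase hl]
  · simp only [hi, if_false]
    refine Finset.sum_eq_zero fun j _ => ?_
    by_cases hj : j ∈ J
    · have : i ≠ j := by rintro rfl; exact hi hj
      simp [gaudinMatrix, hi, this]
    · simp [hj]

theorem det_updateCol_finsum (A : Matrix ι ι ℂ) (k : ι) (B : Finset κ) (f : κ → ι → ℂ) :
    (A.updateCol k (fun i => ∑ a ∈ B, f a i)).det = ∑ a ∈ B, (A.updateCol k (f a)).det := by
  simp only [← Matrix.cramer_apply]
  have : (fun i => ∑ a ∈ B, f a i) = ∑ a ∈ B, f a := by ext i; simp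
  rw [this, map_sum, Finset.sum_apply]

variable [DecidableEq κ]

theorem det_updateCol_partialEbv {z : ι → ℂ} (hz : Function.Injective z) {v : κ → ℂ}
    (hv : ∀ i a, z i ≠ v a) {J : Finset ι} {k : ι} (hk : k ∈ J) (B : Finset κ) (W : ι → ℂ) :
    ((gaudinMatrix z J (fun i => W i + partialEbv z v B i)).updateCol k
        (fun i => if i ∈ J then partialEbv z v B i else 0)).det
      = ∑ a ∈ B, 1 / (z k - v a)
          * gaudinDet z (J.erase k) (fun i => W i + partialEbv z v (B.erase a) i) := by
  have h1 : (fun i => if i ∈ J then partialEbv z v B i else 0)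
      = fun i => ∑ a ∈ B, if i ∈ J then 1 / (z i - v a) else 0 := by
    ext i
    by_cases hi : i ∈ J <;> simp [hi, partialEbv]
  rw [h1, det_updateCol_finsum]
  refine Finset.sum_congr rfl fun a ha => ?_
  rw [← det_updateCol_gaudinMatrix_rapidity hz (fun i => hv i a) hk]
  congr 3
  ext i
  rw [partialEbv, ← Finset.sum_erase_add _ _ ha, partialEbv, add_assoc]

/-- Expansion along a node. -/
theorem gaudinDet_partialEbv_insert {z : ι → ℂ} (hz : Function.Injective z) {v : κ → ℂ}
    (hv : ∀ i a, z i ≠ v a) {J : Finset ι} {k : ι} (hk : k ∉ J) (B : Finset κ) (s : ℂ) :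
    gaudinDet z (insert k J) (fun i => s + partialEbv z v B i)
      = s * gaudinDet z J (fun i => s + partialEbv z v B i)
        + ∑ a ∈ B, 1 / (z k - v a)
          * gaudinDet z J (fun i => s + partialEbv z v (B.erase a) i) := by
  have hk' := Finset.mem_insert_self k J
  have e := det_updateCol_partialEbv hz hv hk' B (fun _ => s)
  have e1 := det_updateCol_gaudinMatrix_one hz hk' (fun i => s + partialEbv z v B i)
  rw [Finset.erase_insert hk] at e e1
  -- The row sums are `s` plus the EBV; by linearity in column `k`, the first part leaves `k`
  -- unmatched and the second matches it with some `a`.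
  rw [gaudinDet_eq_det_updateCol z hk', ← e, ← e1, ← Matrix.det_updateCol_smul,
    ← Matrix.det_updateCol_add]
  congr 2
  ext i
  by_cases hi : i ∈ insert k J <;> simp only [hi, Pi.add_apply, Pi.smul_apply] <;> simp

theorem gaudinDet_partialEbv_insert' {z : ι → ℂ} (hz : Function.Injective z) {v : κ → ℂ}
    (hv : ∀ i a, z i ≠ v a) {J : Finset ι} {k : ι} (hk : k ∉ J) (B : Finset κ) :
    gaudinDet z (insert k J) (partialEbv z v B)
      = ∑ a ∈ B, 1 / (z k - v a) * gaudinDet z J (partialEbv z v (B.erase a)) := by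
  simpa using gaudinDet_partialEbv_insert hz hv hk B 0

theorem gaudinDet_const {z : ι → ℂ} (hz : Function.Injective z) (J : Finset ι) (s : ℂ) :
    gaudinDet z J (fun _ => s) = s ^ J.card := by
  induction J using Finset.induction_on with
  | empty => simp [gaudinDet_empty]
  | insert k J hk ih =>
    -- With no rapidities at all, every node is unmatched.
    have := gaudinDet_partialEbv_insert hz (v := (fun a => a.elim : Empty → ℂ))
      (fun _ a => a.elim) hk ∅ s
    simp only [partialEbv, Finset.sum_empty, add_zero] at this
    rw [this, ih, Finset.card_insert_of_notMem hk, pow_succ']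

/-- With zero weight for unmatched nodes, every node needs its own rapidity, and there are too few
of them. -/
theorem gaudinDet_partialEbv_eq_zero {z : ι → ℂ} (hz : Function.Injective z) {v : κ → ℂ}
    (hv : ∀ i a, z i ≠ v a) (J : Finset ι) :
    ∀ B : Finset κ, B.card < J.card → gaudinDet z J (partialEbv z v B) = 0 := by
  induction J using Finset.induction_on with
  | empty => simp
  | insert k J hk ih =>
    intro B hB
    rw [gaudinDet_partialEbv_insert' hz hv hk]
    refine Finset.sum_eq_zero fun a ha => ?_
    rw [ih, mul_zero]
    rw [Finset.card_insert_of_notMem hk] at hB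
    rw [Finset.card_erase_of_mem ha]
    have := Finset.card_pos.2 ⟨a, ha⟩
    omega

theorem gaudinDet_add_partialEbv_insert {z : ι → ℂ} (hz : Function.Injective z) {v : κ → ℂ}
    (hv : ∀ i a, z i ≠ v a) (J : Finset ι) {a : κ} {B : Finset κ} (ha : a ∉ B) (W : ι → ℂ) :
    gaudinDet z J (fun i => W i + partialEbv z v (insert a B) i)
      = gaudinDet z J (fun i => W i + partialEbv z v B i)
        + ∑ i ∈ J, 1 / (z i - v a)
          * gaudinDet z (J.erase i) (fun i => W i + partialEbv z v B i) := by
  rw [← gaudinDet_add_rapidity hz (fun i => hv i a)]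
  congr 1
  ext i
  rw [partialEbv, Finset.sum_insert ha, partialEbv]
  ring

/-- Exchange of the roles of nodes and rapidities. -/
theorem gaudinDet_exchange [Fintype κ] {z : ι → ℂ} (hz : Function.Injective z) {u : κ → ℂ}
    (hu : Function.Injective u) (hzu : ∀ i a, z i ≠ u a) (c : ℂ) (J : Finset ι) :
    ∀ B : Finset κ, (-1) ^ J.card * c ^ B.card * gaudinDet z J (fun i => -c + partialEbv z u B i)
      = c ^ J.card * gaudinDet u B (fun a => c + partialEbv u z J a) := by
  have huz : ∀ a i, u a ≠ z i := fun a i => (hzu i a).symm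
  induction J using Finset.induction_on with
  | empty => intro B; simp [gaudinDet_empty, partialEbv, gaudinDet_const hu]
  | insert k J hk ih =>
    intro B
    rw [gaudinDet_partialEbv_insert hz hzu hk, gaudinDet_add_partialEbv_insert hu huz B hk,
      Finset.card_insert_of_notMem hk, pow_succ, pow_succ, mul_add, mul_add, Finset.mul_sum,
      Finset.mul_sum]
    congr 1
    · linear_combination c * ih B
    · refine Finset.sum_congr rfl fun a ha => ?_
      have h := ih (B.erase a)
      have hc : c ^ B.card = c ^ (B.erase a).card * c := by
        rw [← pow_succ, Finset.card_erase_add_one ha]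
      have h1 : 1 / (u a - z k) = -(1 / (z k - u a)) := by
        rw [← neg_sub (z k) (u a), div_neg]
      rw [hc, h1]
      linear_combination (-c * (1 / (z k - u a))) * h

/-- Both sides are the same Cauchy permanent; the sign comes from `z - u` against `u - z`. The case
`c = 0` of `gaudinDet_exchange` does not give this, because the powers of `c` vanish there. -/
theorem gaudinDet_exchange_perfect [Fintype κ] {z : ι → ℂ} (hz : Function.Injective z) {u : κ → ℂ}
    (hu : Function.Injective u) (hzu : ∀ i a, z i ≠ u a) (J : Finset ι) :
    ∀ B : Finset κ, J.card = B.card →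
      (-1) ^ J.card * gaudinDet z J (partialEbv z u B) = gaudinDet u B (partialEbv u z J) := by
  have huz : ∀ a i, u a ≠ z i := fun a i => (hzu i a).symm
  induction J using Finset.induction_on with
  | empty =>
    intro B hB
    have : B = ∅ := by simpa using hB.symm
    subst this
    simp [gaudinDet_empty]
  | insert k J hk ih =>
    intro B hB
    rw [Finset.card_insert_of_notMem hk] at hB
    have h := gaudinDet_add_partialEbv_insert hu huz B hk (fun _ => 0)
    simp only [zero_add] at h
    rw [gaudinDet_partialEbv_insert' hz hzu hk, h,
      gaudinDet_partialEbv_eq_zero hu huz B J (by omega), Finset.card_insert_of_notMem hk,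
      pow_succ, zero_add, Finset.mul_sum]
    refine Finset.sum_congr rfl fun a ha => ?_
    rw [← ih (B.erase a) (by rw [Finset.card_erase_of_mem ha]; omega)]
    have h1 : 1 / (u a - z k) = -(1 / (z k - u a)) := by
      rw [← neg_sub (z k) (u a), div_neg]
    rw [h1]
    ring

/-- Splitting the diagonal distributes the nodes among the two summands. -/
theorem gaudinDet_add_partialEbv {z : ι → ℂ} (hz : Function.Injective z) {v : κ → ℂ}
    (hv : ∀ i a, z i ≠ v a) (W : ι → ℂ) (B : Finset κ) :
    ∀ J : Finset ι, gaudinDet z J (fun i => W i + partialEbv z v B i)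
      = ∑ I ∈ J.powerset, gaudinDet z I (partialEbv z v B) * gaudinDet z (J \ I) W := by
  induction B using Finset.induction_on with
  | empty =>
    intro J
    rw [Finset.sum_eq_single_of_mem ∅ (by simp)]
    · simp [gaudinDet_empty, partialEbv]
    · intro I _ hI
      rw [gaudinDet_partialEbv_eq_zero hz hv I ∅
        (by simpa using Finset.card_pos.2 (Finset.nonempty_iff_ne_empty.2 hI)), zero_mul]
  | insert a B ha ih =>
    intro J
    have h : ∀ I : Finset ι, gaudinDet z I (partialEbv z v (insert a B))
        = gaudinDet z I (partialEbv z v B)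
          + ∑ i ∈ I, 1 / (z i - v a) * gaudinDet z (I.erase i) (partialEbv z v B) := by
      intro I
      simpa using gaudinDet_add_partialEbv_insert hz hv I ha (fun _ => 0)
    rw [gaudinDet_add_partialEbv_insert hz hv J ha, ih]
    simp only [h, add_mul, Finset.sum_add_distrib]
    congr 1
    simp only [ih, Finset.mul_sum, Finset.sum_mul, Finset.sum_sigma']
    -- A node `i` matched with the new rapidity and a set `I` avoiding `i` correspond to the set
    -- `insert i I` with the marked element `i`.
    refine Finset.sum_bij' (fun p _ => (⟨insert p.1 p.2, p.1⟩ : Σ _ : Finset ι, ι))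
      (fun p _ => (⟨p.2, p.1.erase p.2⟩ : Σ _ : ι, Finset ι)) ?_ ?_ ?_ ?_ ?_
    · rintro ⟨i, I⟩ h
      simp only [Finset.mem_sigma, Finset.mem_powerset] at h ⊢
      exact ⟨Finset.insert_subset h.1 (h.2.trans (Finset.erase_subset _ _)),
        Finset.mem_insert_self _ _⟩
    · rintro ⟨I, i⟩ h
      simp only [Finset.mem_sigma, Finset.mem_powerset] at h ⊢
      exact ⟨h.1 h.2, Finset.erase_subset_erase _ h.1⟩
    · rintro ⟨i, I⟩ h
      simp only [Finset.mem_sigma, Finset.mem_powerset] at h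
      have : i ∉ I := fun hi => by simpa using h.2 hi
      simp [this]
    · rintro ⟨I, i⟩ h
      simp only [Finset.mem_sigma] at h
      simp [Finset.insert_erase h.2]
    · rintro ⟨i, I⟩ h
      simp only [Finset.mem_sigma, Finset.mem_powerset] at h
      have : i ∉ I := fun hi => by simpa using h.2 hi
      have h2 : J \ insert i I = J.erase i \ I := by
        ext j; simp only [Finset.mem_sdiff, Finset.mem_insert, Finset.mem_erase]; tauto
      simp only [Finset.erase_insert this, h2]
      ring

end GaudinDeterminant

/-! ### Consequences of Richardson's equations: particle-hole duality, orthogonality, overlaps. -/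

section Richardson

variable {ι κ : Type*} [Fintype ι] [DecidableEq ι] [Fintype κ] [DecidableEq κ]

/-- Richardson's equations with coupling `2 / c` for rapidities `u` at the nodes `z`. -/
structure RichardsonSolution (z : ι → ℂ) (c : ℂ) (u : κ → ℂ) : Prop where
  nodes_injective : Function.Injective z
  injective : Function.Injective u
  admissible : ∀ i a, z i ≠ u a
  equation : ∀ a, c + ∑ i, 1 / (u a - z i) + ∑ b ∈ Finset.univ.erase a, 2 / (u b - u a) = 0

variable {z : ι → ℂ} {c : ℂ} {u : κ → ℂ}

/-- Richardson's equation identifies the diagonal entries of one matrix with minus those of the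
other: the factor `2` in the interaction of the rapidities supplies one copy of `1 / (u b - u a)` to
each. Off the diagonal, antisymmetry makes minus the transpose agree. -/
theorem RichardsonSolution.gaudinDet_swap (h : RichardsonSolution z c u) (J : Finset ι) :
    gaudinDet u Finset.univ (fun a => c + partialEbv u z J a)
      = (-1) ^ Fintype.card κ * gaudinDet u Finset.univ (partialEbv u z Jᶜ) := by
  rw [gaudinDet, gaudinDet, ← Matrix.det_transpose (gaudinMatrix u _ (partialEbv u z Jᶜ)),
    ← Matrix.det_neg]
  congr 1
  ext a b
  by_cases hab : a = b
  · subst hab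
    have e := h.equation a
    have e1 : ∑ b ∈ Finset.univ.erase a, 2 / (u b - u a)
        = 2 * ∑ b ∈ Finset.univ.erase a, 1 / (u b - u a) := by
      rw [Finset.mul_sum]
      exact Finset.sum_congr rfl fun b _ => by ring
    have e2 : ∑ i, 1 / (u a - z i) = partialEbv u z J a + partialEbv u z Jᶜ a :=
      (Finset.sum_add_sum_compl J _).symm
    rw [e1, e2] at e
    simp only [gaudinMatrix, Matrix.of_apply, if_true, Finset.mem_univ, Matrix.neg_apply,
      Matrix.transpose_apply]
    linear_combination e
  · simp only [gaudinMatrix, Matrix.of_apply, hab, Ne.symm hab, if_true, Finset.mem_univ,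
      Matrix.neg_apply, Matrix.transpose_apply, if_false, and_self]
    rw [← neg_sub (u b) (u a), div_neg]

/-- Particle-hole duality: pass from the nodes `Iᶜ` to the rapidities, swap `Iᶜ` for `I` by
Richardson's equations, and return to the nodes `I`. -/
theorem RichardsonSolution.gaudinDet_compl (h : RichardsonSolution z c u) {I : Finset ι}
    (hI : I.card = Fintype.card κ) :
    (-1) ^ Iᶜ.card * c ^ Fintype.card κ
        * gaudinDet z Iᶜ (fun i => -c + partialEbv z u Finset.univ i)
      = c ^ Iᶜ.card * gaudinDet z I (partialEbv z u Finset.univ) := by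
  have h1 := gaudinDet_exchange h.nodes_injective h.injective h.admissible c Iᶜ Finset.univ
  rw [h.gaudinDet_swap, compl_compl, ← gaudinDet_exchange_perfect h.nodes_injective h.injective
    h.admissible I Finset.univ (by simpa using hI), Finset.card_univ, hI] at h1
  rw [h1]
  have : ((-1 : ℂ) ^ Fintype.card κ) * (-1) ^ Fintype.card κ = 1 := by
    rw [← mul_pow]; simp
  linear_combination (c ^ Iᶜ.card * gaudinDet z I (partialEbv z u Finset.univ)) * this

/-- After the swap, all rapidities would have to be matched into the smaller set `I`. -/
theorem RichardsonSolution.gaudinDet_compl_eq_zero (h : RichardsonSolution z c u) (hc : c ≠ 0)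
    {I : Finset ι} (hI : I.card < Fintype.card κ) :
    gaudinDet z Iᶜ (fun i => -c + partialEbv z u Finset.univ i) = 0 := by
  have h1 := gaudinDet_exchange h.nodes_injective h.injective h.admissible c Iᶜ Finset.univ
  rw [h.gaudinDet_swap, compl_compl, gaudinDet_partialEbv_eq_zero h.injective
    (fun a i => (h.admissible i a).symm) Finset.univ I (by simpa using hI)] at h1
  simpa [hc] using h1

/-- These are the quadratic equations for the EBV: Richardson's equations weighted by `1 / (z i - u
a)` and summed over `a`, so that only the sums over the rapidities survive. -/
theorem RichardsonSolution.quadratic (h : RichardsonSolution z c u) (i : ι) :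
    (-c + partialEbv z u Finset.univ i) * partialEbv z u Finset.univ i
      + ∑ k ∈ Finset.univ.erase i,
        (partialEbv z u Finset.univ i - partialEbv z u Finset.univ k) / (z k - z i) = 0 := by
  set x : ι → κ → ℂ := fun i a => 1 / (z i - u a) with hx
  have hzu : ∀ i a, z i - u a ≠ 0 := fun i a => sub_ne_zero.2 (h.admissible i a)
  have h0 : ∑ a, x i a * (c + ∑ k, 1 / (u a - z k) + ∑ b, 2 / (u b - u a)) = 0 := by
    refine Finset.sum_eq_zero fun a _ => ?_
    have e := h.equation a
    -- The term `b = a` is `2 / 0 = 0`, so the sum may run over all `b`.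
    rw [Finset.sum_erase _ (by simp)] at e
    rw [e, mul_zero]
  have h1 : ∑ a, x i a * ∑ b, 2 / (u b - u a)
      = ∑ a, x i a * x i a - (∑ a, x i a) * ∑ a, x i a := by
    have s1 : ∑ a, x i a * ∑ b, 2 / (u b - u a)
        = ∑ a, ∑ b, (x i a / (u b - u a) + x i a / (u b - u a)) := by
      refine Finset.sum_congr rfl fun a _ => ?_
      rw [Finset.mul_sum]
      exact Finset.sum_congr rfl fun b _ => by ring
    -- Symmetrizing in `a` and `b` makes partial fractions turn each off-diagonal term into `-(x i a
    -- * x i b)`.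
    have s2 : ∑ a, ∑ b, x i a / (u b - u a) = ∑ a, ∑ b, -(x i b / (u b - u a)) := by
      rw [Finset.sum_comm]
      refine Finset.sum_congr rfl fun a _ => Finset.sum_congr rfl fun b _ => ?_
      rw [← neg_sub (u b) (u a), div_neg]
    have s3 : ∀ a b, x i a / (u b - u a) + -(x i b / (u b - u a))
        = (if a = b then x i a * x i a else 0) - x i a * x i b := by
      intro a b
      by_cases hab : a = b
      · subst hab; simp
      · have hba : u b - u a ≠ 0 := by simp [sub_eq_zero, h.injective.eq_iff, Ne.symm hab]
        have ha := hzu i a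
        have hb := hzu i b
        simp only [hab, if_false, hx]
        field_simp
        ring
    rw [s1]
    simp only [Finset.sum_add_distrib]
    nth_rewrite 2 [s2]
    simp only [← Finset.sum_add_distrib, s3, Finset.sum_sub_distrib, Finset.sum_ite_eq,
      Finset.mem_univ, if_true, Finset.sum_mul_sum]
  have h2 : ∑ a, x i a * ∑ k, 1 / (u a - z k)
      = -(∑ a, x i a * x i a) - ∑ k ∈ Finset.univ.erase i,
        (∑ a, x i a - ∑ a, x k a) / (z k - z i) := by
    have s1 : ∑ a, x i a * ∑ k, 1 / (u a - z k) = -∑ k, ∑ a, x i a * x k a := by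
      simp only [Finset.mul_sum, ← Finset.sum_neg_distrib]
      rw [Finset.sum_comm]
      refine Finset.sum_congr rfl fun k _ => Finset.sum_congr rfl fun a _ => ?_
      rw [← neg_sub (z k) (u a), div_neg, mul_neg]
    -- The term `k = i` is the sum of squares that cancels the one in `h1`.
    rw [s1, ← Finset.add_sum_erase _ _ (Finset.mem_univ i), neg_add, ← sub_eq_add_neg]
    congr 1
    refine Finset.sum_congr rfl fun k hk => ?_
    have hki : z k - z i ≠ 0 := by
      simp [sub_eq_zero, h.nodes_injective.eq_iff, Finset.ne_of_mem_erase hk]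
    rw [← Finset.sum_sub_distrib, Finset.sum_div]
    refine Finset.sum_congr rfl fun a _ => ?_
    have ha := hzu i a
    have hb := hzu k a
    simp only [hx]
    field_simp
    ring
  simp only [mul_add, Finset.sum_add_distrib, h1, h2, ← Finset.sum_mul] at h0
  simp only [partialEbv]
  simp only [hx] at h0
  linear_combination -h0

/-- On-shell states with different eigenvalue-based variables are orthogonal. -/
theorem RichardsonSolution.gaudinDet_eq_zero (h : RichardsonSolution z c u) {v : κ → ℂ}
    (h' : RichardsonSolution z c v)
    (hne : partialEbv z u Finset.univ ≠ partialEbv z v Finset.univ) :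
    gaudinDet z Finset.univ
      (fun i => -c + partialEbv z u Finset.univ i + partialEbv z v Finset.univ i) = 0 := by
  -- The difference of the two EBV vectors lies in the kernel: applying the matrix to it gives the
  -- difference of the two quadratic equations.
  refine Matrix.exists_mulVec_eq_zero_iff.1 ⟨_, sub_ne_zero.2 hne, ?_⟩
  ext i
  rw [gaudinMatrix_mulVec _ _ _ _ _ (Finset.mem_univ i)]
  have e1 := h.quadratic i
  have e2 := h'.quadratic i
  simp only [Pi.sub_apply, Pi.zero_apply]
  have : ∀ k, (partialEbv z u Finset.univ i - partialEbv z v Finset.univ i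
        - (partialEbv z u Finset.univ k - partialEbv z v Finset.univ k)) / (z k - z i)
      = (partialEbv z u Finset.univ i - partialEbv z u Finset.univ k) / (z k - z i)
        - (partialEbv z v Finset.univ i - partialEbv z v Finset.univ k) / (z k - z i) := by
    intro k; ring
  simp only [this, Finset.sum_sub_distrib]
  linear_combination e1 - e2

/-- The proportionality constant between an on-shell state and its particle-hole dual. -/
noncomputable def dualFactor (N M : ℕ) (c : ℂ) : ℂ :=
  (-1) ^ ((N : ℤ) - (M : ℤ)) * c⁻¹ ^ ((N : ℤ) - 2 * (M : ℤ))

theorem RichardsonSolution.dualFactor_mul (h : RichardsonSolution z c u) (hc : c ≠ 0)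
    {I : Finset ι} (hI : I.card = Fintype.card κ) :
    dualFactor (Fintype.card ι) (Fintype.card κ) c
        * gaudinDet z Iᶜ (fun i => -c + partialEbv z u Finset.univ i)
      = gaudinDet z I (partialEbv z u Finset.univ) := by
  have h1 := h.gaudinDet_compl hI
  have hcard : Iᶜ.card + Fintype.card κ = Fintype.card ι := by
    rw [← hI, Finset.card_compl_add_card]
  have h2 : dualFactor (Fintype.card ι) (Fintype.card κ) c * c ^ Iᶜ.card
      = (-1) ^ Iᶜ.card * c ^ Fintype.card κ := by
    -- The exponents are integers because `N - 2 M` may be negative.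
    have e1 : (Fintype.card ι : ℤ) - Fintype.card κ = Iᶜ.card := by omega
    have e2 : (Fintype.card ι : ℤ) - 2 * Fintype.card κ = (Iᶜ.card : ℤ) - Fintype.card κ := by
      omega
    rw [dualFactor, e1, e2, inv_zpow, ← zpow_neg, neg_sub, zpow_sub₀ hc, zpow_natCast,
      zpow_natCast, zpow_natCast]
    field_simp
  have hcp : c ^ Iᶜ.card ≠ 0 := pow_ne_zero _ hc
  refine mul_left_cancel₀ hcp ?_
  rw [← h1, ← h2]
  ring

variable {v : κ → ℂ}

/-- Only sets of size `M` contribute: on smaller ones the dual factor vanishes, on larger ones the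
factor in `v` does. -/
theorem RichardsonSolution.gaudinDet_mul_compl (h : RichardsonSolution z c u) (hc : c ≠ 0)
    (hv : ∀ i a, z i ≠ v a) (I : Finset ι) :
    dualFactor (Fintype.card ι) (Fintype.card κ) c
        * (gaudinDet z I (partialEbv z v Finset.univ)
          * gaudinDet z Iᶜ (fun i => -c + partialEbv z u Finset.univ i))
      = if I.card = Fintype.card κ then
          gaudinDet z I (partialEbv z u Finset.univ) * gaudinDet z I (partialEbv z v Finset.univ)
        else 0 := by
  rcases lt_trichotomy I.card (Fintype.card κ) with hI | hI | hI
  · rw [h.gaudinDet_compl_eq_zero hc hI, if_neg hI.ne, mul_zero, mul_zero]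
  · rw [if_pos hI, ← h.dualFactor_mul hc hI]
    ring
  · rw [gaudinDet_partialEbv_eq_zero h.nodes_injective hv I Finset.univ (by simpa using hI),
      if_neg hI.ne', zero_mul, mul_zero]

theorem RichardsonSolution.overlap (h : RichardsonSolution z c u) (hc : c ≠ 0)
    (hv : ∀ i a, z i ≠ v a) :
    ∑ I : Finset ι, (if I.card = Fintype.card κ then
        gaudinDet z I (partialEbv z u Finset.univ) * gaudinDet z I (partialEbv z v Finset.univ)
      else 0)
      = dualFactor (Fintype.card ι) (Fintype.card κ) c * gaudinDet z Finset.univ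
        (fun i => -c + partialEbv z u Finset.univ i + partialEbv z v Finset.univ i) := by
  rw [gaudinDet_add_partialEbv h.nodes_injective hv, Finset.powerset_univ, Finset.mul_sum]
  refine Finset.sum_congr rfl fun I _ => ?_
  rw [← Finset.compl_eq_univ_sdiff, h.gaudinDet_mul_compl hc hv]

theorem RichardsonSolution.overlap_occupation (h : RichardsonSolution z c u) (hc : c ≠ 0)
    (hv : ∀ i a, z i ≠ v a) (k : ι) :
    ∑ I : Finset ι, (if I.card = Fintype.card κ ∧ k ∈ I then
        gaudinDet z I (partialEbv z u Finset.univ) * gaudinDet z I (partialEbv z v Finset.univ)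
      else 0)
      = dualFactor (Fintype.card ι) (Fintype.card κ) c * ((gaudinMatrix z Finset.univ
        (fun i => -c + partialEbv z u Finset.univ i + partialEbv z v Finset.univ i)).updateCol k
          (partialEbv z v Finset.univ)).det := by
  have h1 := det_updateCol_partialEbv h.nodes_injective hv (Finset.mem_univ k) Finset.univ
    (fun i => -c + partialEbv z u Finset.univ i)
  simp only [Finset.mem_univ, if_true] at h1
  -- Summing over the rapidity matched with `k` restores the factor on `insert k I`, so exactly the
  -- sets containing `k` remain.
  have h2 : ∀ I ∈ (Finset.univ.erase k).powerset, ∑ a, 1 / (z k - v a)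
      * (gaudinDet z I (partialEbv z v (Finset.univ.erase a))
        * gaudinDet z (Finset.univ.erase k \ I) (fun i => -c + partialEbv z u Finset.univ i))
      = gaudinDet z (insert k I) (partialEbv z v Finset.univ)
        * gaudinDet z (insert k I)ᶜ (fun i => -c + partialEbv z u Finset.univ i) := by
    intro I hI
    have hk : k ∉ I := fun hk => by simpa using Finset.mem_powerset.1 hI hk
    have e : Finset.univ.erase k \ I = (insert k I)ᶜ := by
      ext j; simp
    rw [gaudinDet_partialEbv_insert' h.nodes_injective hv hk, Finset.sum_mul, e]
    exact Finset.sum_congr rfl fun a _ => by ring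
  have h3 : ∀ a, gaudinDet z (Finset.univ.erase k) (fun i => -c + partialEbv z u Finset.univ i
        + partialEbv z v (Finset.univ.erase a) i) = _ := fun a =>
    gaudinDet_add_partialEbv h.nodes_injective hv _ _ _
  rw [← Finset.sum_filter, h1]
  simp only [h3, Finset.mul_sum]
  rw [Finset.sum_comm]
  simp only [← Finset.mul_sum]
  rw [Finset.sum_congr rfl h2, Finset.mul_sum]
  simp only [h.gaudinDet_mul_compl hc hv]
  rw [← Finset.sum_filter]
  refine Finset.sum_bij' (fun I _ => I.erase k) (fun I _ => insert k I) ?_ ?_ ?_ ?_ ?_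
  · intro I hI
    simp only [Finset.mem_filter, Finset.mem_univ, true_and, Finset.mem_powerset] at hI ⊢
    exact ⟨Finset.erase_subset_erase _ (Finset.subset_univ _), by
      rw [Finset.insert_erase hI.2]; exact hI.1⟩
  · intro I hI
    simp only [Finset.mem_filter, Finset.mem_univ, true_and] at hI ⊢
    exact ⟨hI.2, Finset.mem_insert_self _ _⟩
  · intro I hI
    simp only [Finset.mem_filter, Finset.mem_univ, true_and] at hI
    exact Finset.insert_erase hI.2
  · intro I hI
    simp only [Finset.mem_filter, Finset.mem_powerset] at hI
    exact Finset.erase_insert fun hk => by simpa using hI.1 hk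
  · intro I hI
    simp only [Finset.mem_filter, Finset.mem_univ, true_and] at hI
    rw [Finset.insert_erase hI.2]

end Richardson

/-! ### Expansion of the states in an orthonormal family of pair states. -/

section Fock

variable {N L : ℕ}

theorem mode_inj {p q : Fin L} {s t : Bool} : mode p s = mode q t ↔ p = q ∧ s = t := by
  simp [mode]

theorem exists_eq_mode (q : Mode L) : ∃ p s, q = mode p s :=
  ⟨(ofLex q).1, (ofLex q).2, rfl⟩

/-- The two spins of an orbital are adjacent in the mode order, so the two fermionic signs of a pair
cancel. -/
theorem lt_mode_true_iff {p : Fin L} {q : Mode L} (hq : q ≠ mode p false) :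
    q < mode p true ↔ q < mode p false := by
  obtain ⟨r, s, rfl⟩ := exists_eq_mode q
  simp only [ne_eq, mode_inj, not_and, Bool.not_eq_false] at hq
  simp only [mode, Prod.Lex.toLex_lt_toLex]
  cases s
  · have : r ≠ p := fun h => by simpa using hq h
    simp [this]
  · simp

theorem fsign_mul_self (p : Mode L) (S : Finset (Mode L)) : fsign p S * fsign p S = 1 := by
  rw [fsign, ← mul_pow]; simp

theorem fsign_erase_self (p : Mode L) (S : Finset (Mode L)) : fsign p (S.erase p) = fsign p S := by
  rw [fsign, fsign, Finset.filter_erase, Finset.erase_eq_of_notMem (by simp)]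

theorem fsign_true_erase_false (p : Fin L) (S : Finset (Mode L)) :
    fsign (mode p true) (S.erase (mode p false)) = fsign (mode p false) S := by
  rw [← fsign_erase_self (mode p false), fsign, fsign]
  congr 2
  refine Finset.filter_congr fun q hq => ?_
  exact lt_mode_true_iff (Finset.ne_of_mem_erase hq)

theorem pairCreate_apply (p : Fin L) (ψ : Fock L) (S : Finset (Mode L)) :
    pairCreate p ψ S = if mode p false ∈ S ∧ mode p true ∈ S then
      ψ ((S.erase (mode p false)).erase (mode p true)) else 0 := by
  have hne : mode p true ≠ mode p false := by simp [mode_inj]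
  have h : pairCreate p ψ S = if mode p false ∈ S then fsign (mode p false) S *
      (if mode p true ∈ S.erase (mode p false) then
        fsign (mode p true) (S.erase (mode p false)) *
          ψ ((S.erase (mode p false)).erase (mode p true)) else 0) else 0 := rfl
  rw [h, fsign_true_erase_false]
  by_cases h1 : mode p false ∈ S <;> by_cases h2 : mode p true ∈ S <;>
    simp [h1, h2, hne, ← mul_assoc, fsign_mul_self]

theorem create_annihilate_apply (q : Mode L) (ψ : Fock L) (S : Finset (Mode L)) :
    (create q * annihilate q) ψ S = if q ∈ S then ψ S else 0 := by
  have h : (create q * annihilate q) ψ S = if q ∈ S then fsign q S *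
      (if q ∈ S.erase q then 0 else fsign q (S.erase q) * ψ (insert q (S.erase q))) else 0 := rfl
  rw [h, fsign_erase_self]
  by_cases h1 : q ∈ S <;> simp [h1, ← mul_assoc, fsign_mul_self]

theorem numberOp_apply (p : Fin L) (ψ : Fock L) (S : Finset (Mode L)) :
    numberOp p ψ S = (if mode p false ∈ S then ψ S else 0)
      + (if mode p true ∈ S then ψ S else 0) := by
  rw [← create_annihilate_apply, ← create_annihilate_apply]
  simp only [numberOp, spinZ, LinearMap.add_apply, LinearMap.sub_apply, LinearMap.smul_apply,
    PiLp.add_apply, PiLp.sub_apply, PiLp.smul_apply, smul_eq_mul, Module.End.one_apply]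
  ring

/-- The modes of the pairing orbitals in `I`. -/
def orbModes (orb : Fin N ↪ Fin L) (I : Finset (Fin N)) : Finset (Mode L) :=
  Finset.univ.filter fun q => ∃ i ∈ I, orb i = (ofLex q).1

theorem mode_mem_orbModes {orb : Fin N ↪ Fin L} {I : Finset (Fin N)} {p : Fin L} {s : Bool} :
    mode p s ∈ orbModes orb I ↔ ∃ i ∈ I, orb i = p := by
  simp [orbModes, mode]

theorem mode_orb_mem_orbModes {orb : Fin N ↪ Fin L} {I : Finset (Fin N)} {k : Fin N} {s : Bool} :
    mode (orb k) s ∈ orbModes orb I ↔ k ∈ I := by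
  simp [mode_mem_orbModes]

/-- The number operator is diagonal on determinants, with eigenvalue 1 or 2 as soon as one mode of
the orbital is occupied. -/
theorem IsPairVacuum.apply_eq_zero {orb : Fin N ↪ Fin L} {θ : Fock L} (hθ : IsPairVacuum orb θ)
    {S : Finset (Mode L)} {i : Fin N} {s : Bool} (h : mode (orb i) s ∈ S) : θ S = 0 := by
  have h1 : numberOp (orb i) θ S = 0 := by rw [hθ.numberOp_eq_zero i]; rfl
  rw [numberOp_apply] at h1
  cases s
  · by_cases h2 : mode (orb i) true ∈ S <;> simpa [h, h2, ← two_mul] using h1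
  · by_cases h2 : mode (orb i) false ∈ S <;> simpa [h, h2, ← two_mul] using h1

/-- The state obtained from `θ` by filling the pairing orbitals in `I` with a pair each. -/
noncomputable def pairState (orb : Fin N ↪ Fin L) (θ : Fock L) (I : Finset (Fin N)) : Fock L :=
  WithLp.toLp 2 fun S => if orbModes orb I ⊆ S then θ (S \ orbModes orb I) else 0

theorem pairState_apply (orb : Fin N ↪ Fin L) (θ : Fock L) (I : Finset (Fin N))
    (S : Finset (Mode L)) :
    pairState orb θ I S = if orbModes orb I ⊆ S then θ (S \ orbModes orb I) else 0 := rfl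

theorem pairState_empty (orb : Fin N ↪ Fin L) (θ : Fock L) : pairState orb θ ∅ = θ := by
  ext S
  simp [pairState_apply, orbModes]

theorem orbModes_insert (orb : Fin N ↪ Fin L) (i : Fin N) (I : Finset (Fin N)) :
    orbModes orb (insert i I)
      = insert (mode (orb i) false) (insert (mode (orb i) true) (orbModes orb I)) := by
  ext q
  obtain ⟨p, s, rfl⟩ := exists_eq_mode q
  cases s <;> simp [mode_mem_orbModes, mode_inj, eq_comm]

theorem pairCreate_pairState (orb : Fin N ↪ Fin L) (θ : Fock L) (i : Fin N)
    (I : Finset (Fin N)) :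
    pairCreate (orb i) (pairState orb θ I)
      = if i ∈ I then 0 else pairState orb θ (insert i I) := by
  ext S
  rw [pairCreate_apply, pairState_apply]
  by_cases hi : i ∈ I
  · have : ¬ orbModes orb I ⊆ (S.erase (mode (orb i) false)).erase (mode (orb i) true) := by
      intro h
      simpa using h (mode_orb_mem_orbModes.2 hi : mode (orb i) true ∈ _)
    simp [hi, this]
  · rw [if_neg hi, pairState_apply, orbModes_insert]
    have hf : mode (orb i) false ∉ orbModes orb I := by rwa [mode_orb_mem_orbModes]
    have ht : mode (orb i) true ∉ orbModes orb I := by rwa [mode_orb_mem_orbModes]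
    simp only [Finset.insert_subset_iff, Finset.subset_erase, hf, ht, not_false_eq_true, and_true,
      ← and_assoc, ite_and]
    have hset : (S.erase (mode (orb i) false)).erase (mode (orb i) true) \ orbModes orb I
        = S \ insert (mode (orb i) false) (insert (mode (orb i) true) (orbModes orb I)) := by
      ext q
      simp only [Finset.mem_sdiff, Finset.mem_erase, Finset.mem_insert]
      tauto
    rw [hset]

theorem IsPairVacuum.mem_of_pairState_ne_zero {orb : Fin N ↪ Fin L} {θ : Fock L}
    (hθ : IsPairVacuum orb θ) {I : Finset (Fin N)} {S : Finset (Mode L)}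
    (h : pairState orb θ I S ≠ 0) (k : Fin N) (s : Bool) : mode (orb k) s ∈ S ↔ k ∈ I := by
  rw [pairState_apply] at h
  split_ifs at h with hS
  · refine ⟨fun hk => ?_, fun hk => hS (mode_orb_mem_orbModes.2 hk)⟩
    by_contra hkI
    refine h (hθ.apply_eq_zero (i := k) (s := s) ?_)
    simp [hk, mode_orb_mem_orbModes, hkI]
  · exact absurd rfl h

theorem IsPairVacuum.numberOp_pairState {orb : Fin N ↪ Fin L} {θ : Fock L}
    (hθ : IsPairVacuum orb θ) (k : Fin N) (I : Finset (Fin N)) :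
    numberOp (orb k) (pairState orb θ I)
      = (if k ∈ I then 2 else 0 : ℂ) • pairState orb θ I := by
  ext S
  rw [numberOp_apply, PiLp.smul_apply, smul_eq_mul]
  by_cases h : pairState orb θ I S = 0
  · simp [h]
  · simp only [hθ.mem_of_pairState_ne_zero h]
    by_cases hk : k ∈ I <;> simp [hk, two_mul]

theorem IsPairVacuum.inner_pairState {orb : Fin N ↪ Fin L} {θ : Fock L}
    (hθ : IsPairVacuum orb θ) (I I' : Finset (Fin N)) :
    inner ℂ (pairState orb θ I) (pairState orb θ I') = if I = I' then (1 : ℂ) else 0 := by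
  by_cases hI : I = I'
  · subst hI
    rw [if_pos rfl]
    have h1 : inner ℂ θ θ = (1 : ℂ) := by
      rw [inner_self_eq_norm_sq_to_K, hθ.norm_eq_one]; simp
    rw [← h1, PiLp.inner_apply, PiLp.inner_apply]
    -- Removing the filled modes matches the support of the pair state with that of `θ`.
    refine Finset.sum_bij_ne_zero (fun S _ _ => S \ orbModes orb I) (by simp) ?_ ?_ ?_
    · intro S _ hS T _ hT hST
      have hS' : orbModes orb I ⊆ S := by
        by_contra h; simp [pairState_apply, h] at hS
      have hT' : orbModes orb I ⊆ T := by
        by_contra h; simp [pairState_apply, h] at hT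
      rw [← Finset.sdiff_union_of_subset hS', hST, Finset.sdiff_union_of_subset hT']
    · intro T _ hT
      have hd : Disjoint T (orbModes orb I) := by
        rw [Finset.disjoint_left]
        intro q hq hq'
        obtain ⟨p, s, rfl⟩ := exists_eq_mode q
        obtain ⟨i, _, rfl⟩ := mode_mem_orbModes.1 hq'
        simp [hθ.apply_eq_zero hq] at hT
      refine ⟨T ∪ orbModes orb I, Finset.mem_univ _, ?_, Finset.union_sdiff_cancel_right hd⟩
      simpa [pairState_apply, Finset.union_sdiff_cancel_right hd] using hT
    · intro S _ hS
      have hS' : orbModes orb I ⊆ S := by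
        by_contra h; simp [pairState_apply, h] at hS
      simp [pairState_apply, hS']
  · rw [if_neg hI, PiLp.inner_apply]
    refine Finset.sum_eq_zero fun S _ => ?_
    by_contra h
    have h1 : pairState orb θ I S ≠ 0 := fun h' => by simp [h'] at h
    have h2 : pairState orb θ I' S ≠ 0 := fun h' => by simp [h'] at h
    refine hI (Finset.ext fun k => ?_)
    rw [← hθ.mem_of_pairState_ne_zero h1 k true, hθ.mem_of_pairState_ne_zero h2 k true]

/-- The coordinates of `rgState` along the states `pairState`, up to the sign `(-1) ^ M`. -/
noncomputable def pairCoeff {M : ℕ} (ε : Fin N → ℝ) (v : Fin M → ℂ) (I : Finset (Fin N)) : ℂ :=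
  if I.card = M then gaudinDet (fun i => (ε i : ℂ)) I (ebv ε v) else 0

theorem partialEbv_univ {M : ℕ} (ε : Fin N → ℝ) (v : Fin M → ℂ) :
    partialEbv (fun i => (ε i : ℂ)) v Finset.univ = ebv ε v := rfl

/-- The first rapidity must be matched: the remaining `M` cannot serve `M + 1` nodes. -/
theorem pairCoeff_cons {M : ℕ} {ε : Fin N → ℝ} (hε : Function.Injective ε)
    {v : Fin (M + 1) → ℂ} (hv : Admissible ε v) (I : Finset (Fin N)) :
    pairCoeff ε v I
      = ∑ i ∈ I, 1 / ((ε i : ℂ) - v 0) * pairCoeff ε (fun a => v a.succ) (I.erase i) := by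
  have hz : Function.Injective fun i => (ε i : ℂ) := fun i j h => hε (by simpa using h)
  have h1 : ebv ε v = fun i => ebv ε (fun a => v a.succ) i + 1 / ((ε i : ℂ) - v 0) := by
    ext i
    rw [ebv, Fin.sum_univ_succ, add_comm]
    rfl
  by_cases hI : I.card = M + 1
  · rw [pairCoeff, if_pos hI, h1, gaudinDet_add_rapidity hz (fun i => (hv 0 i).symm),
      ← partialEbv_univ, gaudinDet_partialEbv_eq_zero hz (fun i a => (hv a.succ i).symm) I _
        (by simp [hI]), zero_add]
    refine Finset.sum_congr rfl fun i hi => ?_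
    rw [pairCoeff, if_pos (by rw [Finset.card_erase_of_mem hi, hI]; rfl), partialEbv_univ]
  · rw [pairCoeff, if_neg hI, Finset.sum_eq_zero]
    intro i hi
    have h2 := Finset.card_erase_add_one hi
    rw [pairCoeff, if_neg (by omega), mul_zero]

theorem rgState_eq_sum (orb : Fin N ↪ Fin L) (θ : Fock L) {ε : Fin N → ℝ}
    (hε : Function.Injective ε) {M : ℕ} {v : Fin M → ℂ} (hv : Admissible ε v) :
    rgState orb θ ε v
      = ∑ I : Finset (Fin N), ((-1) ^ M * pairCoeff ε v I) • pairState orb θ I := by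
  induction M with
  | zero =>
    rw [Finset.sum_eq_single_of_mem ∅ (Finset.mem_univ _)]
    · simp [rgState, pairCoeff, gaudinDet_empty, pairState_empty]
    · intro I _ hI
      simp [pairCoeff, hI]
  | succ M ih =>
    have h1 : rgState orb θ ε v
        = pairCreator orb ε (v 0) (rgState orb θ ε (fun a => v a.succ)) := by
      simp [rgState, List.ofFn_succ]
    rw [h1, ih (fun a i => hv a.succ i), map_sum]
    simp only [pairCoeff_cons hε hv, Finset.mul_sum, Finset.sum_smul, map_smul, pairCreator,
      LinearMap.sum_apply, LinearMap.smul_apply, pairCreate_pairState, Finset.smul_sum]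
    have h2 : ∀ (I : Finset (Fin N)) (i : Fin N),
        ((-1) ^ M * pairCoeff ε (fun a => v a.succ) I) • (1 / (v 0 - (ε i : ℂ))) •
          (if i ∈ I then 0 else pairState orb θ (insert i I))
        = if i ∉ I then ((-1) ^ M * pairCoeff ε (fun a => v a.succ) I) • (1 / (v 0 - (ε i : ℂ))) •
          pairState orb θ (insert i I) else 0 := by
      intro I i
      by_cases hi : i ∈ I <;> simp [hi]
    simp only [h2, ← Finset.sum_filter]
    rw [Finset.sum_sigma', Finset.sum_sigma']
    refine Finset.sum_bij' (fun p _ => (⟨insert p.2 p.1, p.2⟩ : Σ _ : Finset (Fin N), Fin N))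
      (fun p _ => (⟨p.1.erase p.2, p.2⟩ : Σ _ : Finset (Fin N), Fin N)) ?_ ?_ ?_ ?_ ?_
    · rintro ⟨I, i⟩ _; simp
    · rintro ⟨I, i⟩ _; simp
    · rintro ⟨I, i⟩ h
      simp only [Finset.mem_sigma, Finset.mem_filter, Finset.mem_univ, true_and] at h
      simp [h]
    · rintro ⟨I, i⟩ h
      simp only [Finset.mem_sigma, Finset.mem_univ, true_and] at h
      simp [Finset.insert_erase h]
    · rintro ⟨I, i⟩ h
      simp only [Finset.mem_sigma, Finset.mem_filter, Finset.mem_univ, true_and] at h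
      simp only [Finset.erase_insert h, smul_smul]
      congr 1
      -- The pair creator has `v - ε` in the denominator and the EBV `ε - v`; this is one factor
      -- `-1` per rapidity.
      rw [← neg_sub (ε i : ℂ) (v 0), div_neg, pow_succ]
      ring

theorem IsPairVacuum.inner_sum_pairState {orb : Fin N ↪ Fin L} {θ : Fock L}
    (hθ : IsPairVacuum orb θ) (f g : Finset (Fin N) → ℂ) :
    inner ℂ (∑ I, f I • pairState orb θ I) (∑ I, g I • pairState orb θ I)
      = ∑ I, starRingEnd ℂ (f I) * g I := by
  simp only [sum_inner, inner_sum, inner_smul_left, inner_smul_right, hθ.inner_pairState]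
  refine Finset.sum_congr rfl fun I _ => ?_
  simp [mul_comm]

theorem neg_one_pow_mul_conj (M : ℕ) (x y : ℂ) :
    starRingEnd ℂ ((-1) ^ M * x) * ((-1) ^ M * y) = starRingEnd ℂ x * y := by
  have : ((-1 : ℂ) ^ M) * (-1) ^ M = 1 := by rw [← mul_pow]; simp
  simp only [map_mul, map_pow, map_neg, map_one]
  linear_combination (starRingEnd ℂ x * y) * this

theorem IsPairVacuum.inner_rgState {orb : Fin N ↪ Fin L} {θ : Fock L}
    (hθ : IsPairVacuum orb θ) {ε : Fin N → ℝ} (hε : Function.Injective ε) {M : ℕ}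
    {u v : Fin M → ℂ} (hu : Admissible ε u) (hv : Admissible ε v) :
    inner ℂ (rgState orb θ ε u) (rgState orb θ ε v)
      = ∑ I, starRingEnd ℂ (pairCoeff ε u I) * pairCoeff ε v I := by
  rw [rgState_eq_sum orb θ hε hu, rgState_eq_sum orb θ hε hv, hθ.inner_sum_pairState]
  simp only [neg_one_pow_mul_conj]

theorem IsPairVacuum.inner_numberOp_rgState {orb : Fin N ↪ Fin L} {θ : Fock L}
    (hθ : IsPairVacuum orb θ) {ε : Fin N → ℝ} (hε : Function.Injective ε) {M : ℕ}
    {u v : Fin M → ℂ} (hu : Admissible ε u) (hv : Admissible ε v) (k : Fin N) :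
    (1 / 2 : ℂ) * inner ℂ (rgState orb θ ε u) (numberOp (orb k) (rgState orb θ ε v))
      = ∑ I, if k ∈ I then starRingEnd ℂ (pairCoeff ε u I) * pairCoeff ε v I else 0 := by
  rw [rgState_eq_sum orb θ hε hu, rgState_eq_sum orb θ hε hv, map_sum]
  simp only [map_smul, hθ.numberOp_pairState, smul_smul]
  rw [hθ.inner_sum_pairState, Finset.mul_sum]
  refine Finset.sum_congr rfl fun I _ => ?_
  by_cases hk : k ∈ I
  · simp only [hk, if_true]
    rw [← neg_one_pow_mul_conj M (pairCoeff ε u I)]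
    ring
  · simp [hk]

end Fock

/-! ### Complex conjugation of the rapidities. -/

section Conjugation

variable {N M : ℕ}

theorem conj_gaudinDet (ε : Fin N → ℝ) (J : Finset (Fin N)) (W : Fin N → ℂ) :
    starRingEnd ℂ (gaudinDet (fun i => (ε i : ℂ)) J W)
      = gaudinDet (fun i => (ε i : ℂ)) J (fun i => starRingEnd ℂ (W i)) := by
  rw [gaudinDet, RingHom.map_det, gaudinDet]
  congr 1
  ext i j
  simp only [RingHom.mapMatrix_apply, Matrix.map_apply, gaudinMatrix, Matrix.of_apply]
  split_ifs <;> simp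

theorem conj_ebv (ε : Fin N → ℝ) (u : Fin M → ℂ) (i : Fin N) :
    starRingEnd ℂ (ebv ε u i) = ebv ε (fun a => starRingEnd ℂ (u a)) i := by
  simp [ebv]

theorem conj_pairCoeff (ε : Fin N → ℝ) (u : Fin M → ℂ) (I : Finset (Fin N)) :
    starRingEnd ℂ (pairCoeff ε u I) = pairCoeff ε (fun a => starRingEnd ℂ (u a)) I := by
  rw [pairCoeff, pairCoeff, apply_ite (starRingEnd ℂ), map_zero, conj_gaudinDet]
  simp only [conj_ebv]

theorem OnShell.conj {ε : Fin N → ℝ} {g : ℝ} {u : Fin M → ℂ} (hu : OnShell ε g u) :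
    OnShell ε g (fun a => starRingEnd ℂ (u a)) where
  admissible a i h := hu.admissible a i (by simpa using congrArg (starRingEnd ℂ) h)
  injective a b h := hu.injective ((starRingEnd ℂ).injective h)
  richardson a := by
    have h2 : starRingEnd ℂ 2 = 2 := map_ofNat _ 2
    simpa [h2] using congrArg (starRingEnd ℂ) (hu.richardson a)

theorem OnShell.richardsonSolution {ε : Fin N → ℝ} (hε : Function.Injective ε) {g : ℝ}
    {u : Fin M → ℂ} (hu : OnShell ε g u) :
    RichardsonSolution (fun i => (ε i : ℂ)) (2 / (g : ℂ)) u where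
  nodes_injective i j h := hε (by simpa using h)
  injective := hu.injective
  admissible i a := (hu.admissible a i).symm
  equation := hu.richardson

end Conjugation

/-! ### Determinant formulas for inner products with an on-shell state. -/

section Overlaps

variable {N M L : ℕ}

theorem matJ_eq_gaudinMatrix (ε : Fin N → ℝ) (g : ℝ) (U V : Fin N → ℂ) :
    matJ ε g U V
      = gaudinMatrix (fun i => (ε i : ℂ)) Finset.univ (fun i => -(2 / (g : ℂ)) + U i + V i) := by
  ext i j
  by_cases h : i = j
  · subst h
    simp only [matJ, gaudinMatrix, Matrix.of_apply, if_true, Finset.mem_univ]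
    ring
  · simp [matJ, gaudinMatrix, h]

theorem dualFactor_eq_eta (N M : ℕ) (g : ℝ) : dualFactor N M (2 / (g : ℂ)) = eta N M g := by
  rw [dualFactor, eta, inv_div]

theorem eta_ne_zero {g : ℝ} (hg : g ≠ 0) : eta N M g ≠ 0 := by
  have : (g : ℂ) / 2 ≠ 0 := by simpa using hg
  exact mul_ne_zero (zpow_ne_zero _ (by simp)) (zpow_ne_zero _ this)

variable {ε : Fin N → ℝ} {g : ℝ} {u v : Fin M → ℂ}

theorem OnShell.sum_pairCoeff (hu : OnShell ε g u) (hε : Function.Injective ε) (hg : g ≠ 0)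
    (hv : Admissible ε v) :
    ∑ I, pairCoeff ε u I * pairCoeff ε v I
      = eta N M g * (matJ ε g (ebv ε u) (ebv ε v)).det := by
  have hc : (2 / (g : ℂ)) ≠ 0 := by simpa using hg
  have h := (hu.richardsonSolution hε).overlap hc (fun i a => (hv a i).symm)
  simp only [Fintype.card_fin, partialEbv_univ, dualFactor_eq_eta] at h
  rw [matJ_eq_gaudinMatrix, ← gaudinDet, ← h]
  refine Finset.sum_congr rfl fun I _ => ?_
  by_cases hI : I.card = M <;> simp [pairCoeff, hI]

theorem OnShell.sum_pairCoeff_occupation (hu : OnShell ε g u) (hε : Function.Injective ε)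
    (hg : g ≠ 0) (hv : Admissible ε v) (k : Fin N) :
    ∑ I, (if k ∈ I then pairCoeff ε u I * pairCoeff ε v I else 0)
      = eta N M g * ((matJ ε g (ebv ε u) (ebv ε v)).updateCol k (ebv ε v)).det := by
  have hc : (2 / (g : ℂ)) ≠ 0 := by simpa using hg
  have h := (hu.richardsonSolution hε).overlap_occupation hc (fun i a => (hv a i).symm) k
  simp only [Fintype.card_fin, partialEbv_univ, dualFactor_eq_eta] at h
  rw [matJ_eq_gaudinMatrix, ← h]
  refine Finset.sum_congr rfl fun I _ => ?_
  by_cases hI : I.card = M <;> by_cases hk : k ∈ I <;> simp [pairCoeff, hI, hk]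

/-- The coordinates of an on-shell state are real. -/
theorem OnShell.conj_pairCoeff_eq (hu : OnShell ε g u) (hε : Function.Injective ε) (hg : g ≠ 0)
    (I : Finset (Fin N)) : starRingEnd ℂ (pairCoeff ε u I) = pairCoeff ε u I := by
  by_cases hU : ebv ε (fun a => starRingEnd ℂ (u a)) = ebv ε u
  · rw [conj_pairCoeff, pairCoeff, pairCoeff, hU]
  -- The conjugate rapidities are also on-shell, with different EBV, so orthogonality makes the sum
  -- of the squared moduli of the coefficients zero.
  · have h0 : ∑ I, starRingEnd ℂ (pairCoeff ε u I) * pairCoeff ε u I = 0 := by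
      have h := (hu.conj.richardsonSolution hε).gaudinDet_eq_zero (hu.richardsonSolution hε) hU
      simp only [partialEbv_univ] at h
      simp only [conj_pairCoeff]
      rw [hu.conj.sum_pairCoeff hε hg hu.admissible, matJ_eq_gaudinMatrix, ← gaudinDet, h,
        mul_zero]
    simp only [← Complex.normSq_eq_conj_mul_self] at h0
    rw [← Complex.ofReal_sum, Complex.ofReal_eq_zero,
      Finset.sum_eq_zero_iff_of_nonneg fun I _ => Complex.normSq_nonneg _] at h0
    have := Complex.normSq_eq_zero.1 (h0 I (Finset.mem_univ I))
    rw [this, map_zero]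

variable {orb : Fin N ↪ Fin L} {θ : Fock L}

theorem IsPairVacuum.inner_onShell (hθ : IsPairVacuum orb θ) (hε : Function.Injective ε)
    (hg : g ≠ 0) (hu : OnShell ε g u) (hv : Admissible ε v) :
    inner ℂ (rgState orb θ ε u) (rgState orb θ ε v)
      = eta N M g * (matJ ε g (ebv ε u) (ebv ε v)).det := by
  rw [hθ.inner_rgState hε hu.admissible hv, ← hu.sum_pairCoeff hε hg hv]
  simp only [hu.conj_pairCoeff_eq hε hg]

theorem IsPairVacuum.inner_numberOp_onShell (hθ : IsPairVacuum orb θ)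
    (hε : Function.Injective ε) (hg : g ≠ 0) (hu : OnShell ε g u) (hv : Admissible ε v)
    (k : Fin N) :
    (1 / 2 : ℂ) * inner ℂ (rgState orb θ ε u) (numberOp (orb k) (rgState orb θ ε v))
      = eta N M g * ((matJ ε g (ebv ε u) (ebv ε v)).updateCol k (ebv ε v)).det := by
  rw [hθ.inner_numberOp_rgState hε hu.admissible hv, ← hu.sum_pairCoeff_occupation hε hg hv]
  simp only [hu.conj_pairCoeff_eq hε hg]

end Overlaps

end RG

/-! ### The main theorem. -/

theorem mainTheorem1 {N M L : ℕ} (orb : Fin N ↪ Fin L) (θ : RG.Fock L)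
    (hθ : RG.IsPairVacuum orb θ)
    (ε : Fin N → ℝ) (hε : Function.Injective ε) (g : ℝ) (hg : g ≠ 0)
    (u : Fin M → ℂ) (hu : RG.OnShell ε g u) :
    (∀ v : Fin M → ℂ, RG.Admissible ε v → ∀ k : Fin N,
      (1 / 2 : ℂ) * inner ℂ (RG.rgState orb θ ε u)
          (RG.numberOp (orb k) (RG.rgState orb θ ε v))
        = RG.eta N M g *
          ((RG.matJ ε g (RG.ebv ε u) (RG.ebv ε v)).updateCol k (RG.ebv ε v)).det) ∧
    (RG.rgState orb θ ε u ≠ 0 →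
      (RG.matJbar ε g (RG.ebv ε u)).det ≠ 0 ∧
      (∀ k : Fin N, RG.oneRDM orb (RG.rgState orb θ ε u) k
        = ((RG.matJbar ε g (RG.ebv ε u)).updateCol k (RG.ebv ε u)).det
          / (RG.matJbar ε g (RG.ebv ε u)).det) ∧
      (∀ x : Fin N → ℂ, (RG.matJbar ε g (RG.ebv ε u)).mulVec x = RG.ebv ε u ↔
        x = RG.oneRDM orb (RG.rgState orb θ ε u)) ∧
      (∀ k : Fin N, RG.oneRDM orb (RG.rgState orb θ ε u) k
        = ∑ l, RG.ebv ε u l * (RG.matJbar ε g (RG.ebv ε u))⁻¹ k l)) := by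
  refine ⟨fun v hv k => hθ.inner_numberOp_onShell hε hg hu hv k, fun hne => ?_⟩
  set U := RG.ebv ε u with hU
  set A := RG.matJbar ε g U with hA
  have hη : RG.eta N M g ≠ 0 := RG.eta_ne_zero hg
  have hnorm : inner ℂ (RG.rgState orb θ ε u) (RG.rgState orb θ ε u) = RG.eta N M g * A.det :=
    hθ.inner_onShell hε hg hu hu.admissible
  -- The squared norm is `η * det J̄`, so a zero determinant would make the state vanish.
  have hdet : A.det ≠ 0 := fun h => by
    rw [h, mul_zero, inner_self_eq_zero] at hnorm
    exact hne hnorm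
  have hunit : IsUnit A.det := isUnit_iff_ne_zero.2 hdet
  have hγ : ∀ k, RG.oneRDM orb (RG.rgState orb θ ε u) k = (A.updateCol k U).det / A.det := by
    intro k
    rw [RG.oneRDM, hnorm, ← mul_div_assoc, hθ.inner_numberOp_onShell hε hg hu hu.admissible k,
      mul_div_mul_left _ _ hη]
    rfl
  -- Cramer's rule.
  have hinv : RG.oneRDM orb (RG.rgState orb θ ε u) = A⁻¹.mulVec U := by
    ext k
    rw [hγ, ← Matrix.cramer_apply, Matrix.cramer_eq_adjugate_mulVec, Matrix.inv_def,
      Matrix.smul_mulVec, Ring.inverse_eq_inv', Pi.smul_apply, smul_eq_mul, div_eq_inv_mul]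
  refine ⟨hdet, hγ, fun x => ?_, fun k => ?_⟩
  · rw [hinv]
    constructor
    · rintro h
      rw [← h, Matrix.mulVec_mulVec, Matrix.nonsing_inv_mul _ hunit, Matrix.one_mulVec]
    · rintro rfl
      rw [Matrix.mulVec_mulVec, Matrix.mul_nonsing_inv _ hunit, Matrix.one_mulVec]
  · rw [hinv, Matrix.mulVec, dotProduct]
    exact Finset.sum_congr rfl fun l _ => mul_comm (A⁻¹ k l) (U l)
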